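/- **Setting.** Let $f\in\mathbb R[\mathbf x]=\mathbb R[x_1,\dots,x_n]$ and let $\mathbf g=(\mathbf g^0,\mathbf g^+)$ be finite sets of polynomials. For a set of constraints $G=(G^0,G^+)$ let $\mathcal S(G)=\{x\in\mathbb R^n: g(x)=0\ \forall g\in G^0,\ g(x)\ge 0\ \forall g\in G^+\}$. Assume that $S=\mathcal S(\mathbf g)$ is non-empty and that $f$ is bounded below on $S$. Put $f^*=\inf_S f$, $V_{min}=\{x\in S: f(x)=f^*\}$, let $I_{min}\subset\mathbb R[\mathbf x]$ be the vanishing ideal of $V_{min}$, $A_{min}=\mathbb R[\mathbf x]/I_{min}$, and let $M_k:A_{min}\to A_{min}$ be the multiplication by $x_k$, $k=1,\dots,n$. For a vector subspace $V\subset\mathbb R[\mathbf x]$ let $V^+=V+x_1V+\dots+x_nV$, and let $\langle V\cdot V\rangle$ be the span of the products of two elements of $V$. $V$ is *connected to $1$* if there are vector spaces $\langle 1\rangle=V_0\subset V_1\subset\dots\subset V_N=V$ with $V_{i+1}\subset V_i^+$. Let $E\subset\mathbb R[\mathbf x]$ be a finite-dimensional vector space connected to $1$, and $G$ a set of constraints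 with $V_{min}\subset\mathcal S(G)\subset S$ and $\inf_{\mathcal S(G)}f=f^*$ (for instance $\mathcal S(G)=S$). Let $\mathcal Q_{E,G}$ be the set of finite sums $\sum_{g\in G^0}g\,h_g+\sum_{g\in G^+\cup\{1\}}g\,\sigma_g$ with $h_g\in E$, $\sigma_g$ a sum of squares of elements of $E$, and all the products $g\,h_g$, $g\,\sigma_g$ in $\langle E\cdot E\rangle$. Let $\mathcal L_{E,G}$ be the set of the linear forms $\Lambda$ on $\langle E\cdot E\rangle$ with $\Lambda\ge 0$ on $\mathcal Q_{E,G}$ and $\Lambda(1)=1$. For $V\subset E$ let $H^V_\Lambda:V\to V^*$, $H^V_\Lambda(p)(q)=\Lambda(pq)$. For $f\in\langle E\cdot E\rangle$, a form $\Lambda^*\in\mathcal L_{E,G}$ is *optimal for $f$* if $\Lambda^*(f)=\inf_{\Lambda\in\mathcal L_{E,G}}\Lambda(f)$ and $\operatorname{rank}H^E_{\Lambda^*}$ is maximal among all $\Lambda\in\mathcal L_{E,G}$ that attain this infimum. The *Decomposition algorithm* on $(E,\Lambda^*)$, with $\langle p,q\rangle_*=\Lambda^*(pq)$, starts with $B=\{1\}$,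 $s=1$. While $s>0$ and $\langle B\rangle^+\subset E$, it computes, with $B=\{b_1,\dots,b_r\}$, the polynomials $b_{j,k}=x_kb_j-\sum_{i=1}^r\frac{\langle x_kb_j,b_i\rangle_*}{\langle b_i,b_i\rangle_*}b_i$, chooses a maximal family $B'$ of pairwise orthogonal elements of the span of the $b_{j,k}$ with $\langle b',b'\rangle_*\ne0$ for $b'\in B'$, and sets $B:=B\cup B'$, $s:=|B'|$. It stops with *success* and returns $B$ if the loop is left with $s=0$ and $\langle B\rangle^+\subset E$. **Proposition.** Let $\Lambda^*\in\mathcal L_{E,G}$ be optimal for $f$ and suppose that the Decomposition algorithm on $(E,\Lambda^*)$ stops with success and returns $B=\{b_1,\dots,b_r\}$. Suppose that the flat extension property holds on a space large enough for the data: there is a vector space $W$ connected to $1$ with $\langle B\rangle^+\subset W\subset E$ (for instance $W=E$) such that $\operatorname{rank}H^W_{\Lambda^*}=\operatorname{rank}H^{\langle B\rangle}_{\Lambda^*}$, $f\in\langle W\cdot W\rangle$, $G^0\cdot\langle B\rangle\subset\langle W\cdot W\rangle$ and $G^+\cdot\langle B\rangle\cdot\langle B\rangle\subset\langle W\cdot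 W\rangle$. Then: 1. $\Lambda^*(b_ib_i)\neq0$ for all $i$, the classes of $b_1,\dots,b_r$ form a basis of $A_{min}$, and for $k=1,\dots,n$ the matrix of $M_k$ in this basis is $$[M_k]=\left(\frac{\Lambda^*(x_k\,b_i\,b_j)}{\Lambda^*(b_i\,b_i)}\right)_{1\le i,j\le r}.$$ 2. $f$ has exactly $r$ minimizer points on $S$, $V_{min}=\{\xi_1,\dots,\xi_r\}$ with $\xi_i=(\xi_{i,1},\dots,\xi_{i,n})\in S$, and the operators $M_1,\dots,M_n$ have $r$ linearly independent common eigenvectors $u_1,\dots,u_r\in A_{min}$ with $M_ku_i=\xi_{i,k}u_i$ for all $i,k$. -/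

import Mathlib

noncomputable section

namespace PolyOpt

/-- The polynomial ring `ℝ[x₁, …, xₙ]`. -/
abbrev Poly (n : ℕ) : Type := MvPolynomial (Fin n) ℝ

/-- A set of constraints `G`: equality constraints `G⁰` and non-negativity constraints `G⁺`. -/
structure Constraints (n : ℕ) where
  eqs : Set (Poly n)
  nonnegs : Set (Poly n)

/-- The basic semi-algebraic set `𝒮(G)`. -/
def Constraints.feasible {n : ℕ} (G : Constraints n) : Set (Fin n → ℝ) :=
  {x | (∀ g ∈ G.eqs, MvPolynomial.eval x g = 0) ∧ ∀ g ∈ G.nonnegs, 0 ≤ MvPolynomial.eval x g}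

/-- The infimum of `f` on `S` (used for `S` non-empty and `f` bounded below on `S`). -/
def infValue {n : ℕ} (f : Poly n) (S : Set (Fin n → ℝ)) : ℝ :=
  sInf ((fun x => MvPolynomial.eval x f) '' S)

/-- The set `V_min` of minimizer points of `f` on `S`. -/
def minimizers {n : ℕ} (f : Poly n) (S : Set (Fin n → ℝ)) : Set (Fin n → ℝ) :=
  {x | x ∈ S ∧ MvPolynomial.eval x f = infValue f S}

/-- The minimizer ideal `I_min`, the vanishing ideal of `V_min`. -/
def minIdeal {n : ℕ} (f : Poly n) (S : Set (Fin n → ℝ)) : Ideal (Poly n) :=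
  MvPolynomial.vanishingIdeal ℝ (minimizers f S)

/-- The quotient algebra `A_min = ℝ[x] / I_min`. -/
abbrev MinAlgebra {n : ℕ} (f : Poly n) (S : Set (Fin n → ℝ)) : Type :=
  Poly n ⧸ minIdeal f S

/-- The operator `M_k : a ↦ x_k a` on `A_min`. -/
def mulOp {n : ℕ} (f : Poly n) (S : Set (Fin n → ℝ)) (k : Fin n) :
    MinAlgebra f S →ₗ[ℝ] MinAlgebra f S :=
  LinearMap.mulLeft ℝ (Ideal.Quotient.mk (minIdeal f S) (MvPolynomial.X k))

/-- The prolongation `E⁺ = E + x₁ E + ⋯ + xₙ E`. -/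
def prolong {n : ℕ} (E : Submodule ℝ (Poly n)) : Submodule ℝ (Poly n) :=
  E ⊔ ⨆ k : Fin n, E.map (LinearMap.mulLeft ℝ (MvPolynomial.X k : Poly n))

theorem le_prolong {n : ℕ} (E : Submodule ℝ (Poly n)) : E ≤ prolong E :=
  le_sup_left

/-- `E` is connected to `1`: it is the last term of a finite increasing sequence
`⟨1⟩ = E₀ ⊆ E₁ ⊆ ⋯` of vector spaces with `E_{i+1} ⊆ E_i⁺`. -/
def ConnectedToOne {n : ℕ} (E : Submodule ℝ (Poly n)) : Prop :=
  ∃ c : ℕ → Submodule ℝ (Poly n), c 0 = Submodule.span ℝ {1} ∧ Monotone c ∧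
    (∀ i, c (i + 1) ≤ prolong (c i)) ∧ ∃ N, c N = E

/-- The set `Σ²(E)` of finite sums of squares of elements of `E`. -/
def sumSquares {n : ℕ} (E : Submodule ℝ (Poly n)) : AddSubmonoid (Poly n) :=
  AddSubmonoid.closure {p | ∃ e ∈ E, p = e ^ 2}

/-- The truncated quadratic module `𝒬_{E,G}`. The product of submodules `E * E` is the span
`⟨E · E⟩` of the products of two elements of `E`. The constraint `1 ≥ 0` always belongs to the
non-negativity constraints, so that the sums of squares themselves are in `𝒬_{E,G}`. -/
def quadModule {n : ℕ} (E : Submodule ℝ (Poly n)) (G : Constraints n) : Set (Poly n) :=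
  {p | ∃ (s t : Finset (Poly n)) (h σ : Poly n → Poly n),
    (↑s ⊆ G.eqs) ∧ (↑t ⊆ insert 1 G.nonnegs) ∧
    (∀ g ∈ s, h g ∈ E ∧ g * h g ∈ E * E) ∧
    (∀ g ∈ t, σ g ∈ sumSquares E ∧ g * σ g ∈ E * E) ∧
    p = ∑ g ∈ s, g * h g + ∑ g ∈ t, g * σ g}

open Classical in
/-- The value `Λ(p)` of a linear form `Λ` on `W` at a polynomial `p` of `W` (it is only used for
`p ∈ W`; the value elsewhere is `0`). -/
def formAt {n : ℕ} {W : Submodule ℝ (Poly n)} (Λ : Module.Dual ℝ W) (p : Poly n) : ℝ :=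
  if h : p ∈ W then Λ ⟨p, h⟩ else 0

/-- The convex set `ℒ_{E,G}` of linear forms on `⟨E · E⟩`. -/
def dualCone {n : ℕ} (E : Submodule ℝ (Poly n)) (G : Constraints n) :
    Set (Module.Dual ℝ ↥(E * E)) :=
  {Λ | (∀ p ∈ quadModule E G, 0 ≤ formAt Λ p) ∧ formAt Λ 1 = 1}

/-- The truncated Hankel operator `H_Λ^E : E → E^*`, `H_Λ^E(p)(q) = Λ(p q)`. -/
def hankel {n : ℕ} (E : Submodule ℝ (Poly n)) (Λ : Module.Dual ℝ ↥(E * E)) :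
    E →ₗ[ℝ] Module.Dual ℝ E :=
  LinearMap.mk₂ ℝ (fun p q => Λ ⟨(p : Poly n) * q, Submodule.mul_mem_mul p.2 q.2⟩)
    (fun p p' q => by rw [← map_add]; congr 1; ext1; simp [add_mul])
    (fun c p q => by rw [← map_smul]; congr 1; ext1; simp)
    (fun p q q' => by rw [← map_add]; congr 1; ext1; simp [mul_add])
    (fun c p q => by rw [← map_smul]; congr 1; ext1; simp)

/-- The rank of `H_Λ^E`. -/
def hankelRank {n : ℕ} (E : Submodule ℝ (Poly n)) (Λ : Module.Dual ℝ ↥(E * E)) : ℕ :=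
  Module.finrank ℝ (LinearMap.range (hankel E Λ))

/-- The restriction to `⟨V · V⟩` of a linear form on `⟨E · E⟩`, for `V ⊆ E`. -/
def restrictForm {n : ℕ} {V E : Submodule ℝ (Poly n)} (h : V ≤ E)
    (Λ : Module.Dual ℝ ↥(E * E)) : Module.Dual ℝ ↥(V * V) :=
  Λ.comp (Submodule.inclusion (mul_le_mul' h h))

/-- For `V ⊆ E`: `H_Λ^E` is a flat extension of `H_Λ^V`, i.e. both have the same rank. -/
def IsFlatExtension {n : ℕ} {V E : Submodule ℝ (Poly n)} (h : V ≤ E)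
    (Λ : Module.Dual ℝ ↥(E * E)) : Prop :=
  hankelRank E Λ = hankelRank V (restrictForm h Λ)

/-- The relaxed infimum `f^μ_{E,G} = inf {Λ(f) : Λ ∈ ℒ_{E,G}}` for `f ∈ ⟨E · E⟩`, equal to `+∞`
if `ℒ_{E,G}` is empty. -/
def relaxedInf {n : ℕ} (f : Poly n) (E : Submodule ℝ (Poly n)) (G : Constraints n) : EReal :=
  ⨅ Λ ∈ dualCone E G, ((formAt Λ f : ℝ) : EReal)

/-- `Λ` is optimal for `f`: it belongs to `ℒ_{E,G}`, attains `f^μ_{E,G}`, and its truncated Hankel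
operator has the largest rank among all such linear forms. -/
def IsOptimalForm {n : ℕ} (f : Poly n) (E : Submodule ℝ (Poly n)) (G : Constraints n)
    (Λ : Module.Dual ℝ ↥(E * E)) : Prop :=
  Λ ∈ dualCone E G ∧ ((formAt Λ f : ℝ) : EReal) = relaxedInf f E G ∧
    ∀ Λ' ∈ dualCone E G, ((formAt Λ' f : ℝ) : EReal) = relaxedInf f E G →
      hankelRank E Λ' ≤ hankelRank E Λ

/-- The linear span of the elements of a list. -/
def spanList {n : ℕ} (B : List (Poly n)) : Submodule ℝ (Poly n) :=
  Submodule.span ℝ {b | b ∈ B}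

/-- `x_k b - ∑_i (⟨x_k b, b_i⟩_* / ⟨b_i, b_i⟩_*) b_i`, the sum over the members `b_i` of the list
`B`, with `⟨p, q⟩_* = Λ(p q)`. -/
def decompResidual {n : ℕ} {E : Submodule ℝ (Poly n)} (Λ : Module.Dual ℝ ↥(E * E))
    (B : List (Poly n)) (b : Poly n) (k : Fin n) : Poly n :=
  MvPolynomial.X k * b -
    (B.map fun c => (formAt Λ (MvPolynomial.X k * b * c) / formAt Λ (c * c)) • c).sum

/-- The span of all `b_{j,k}`. -/
def residualSpan {n : ℕ} {E : Submodule ℝ (Poly n)} (Λ : Module.Dual ℝ ↥(E * E))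
    (B : List (Poly n)) : Submodule ℝ (Poly n) :=
  Submodule.span ℝ {p | ∃ b ∈ B, ∃ k : Fin n, p = decompResidual Λ B b k}

/-- `B'` is a maximal family of pairwise orthogonal, non-isotropic vectors of `L` for the inner
product `⟨p, q⟩_* = Λ(p q)`. -/
def IsMaximalOrthogonal {n : ℕ} {E : Submodule ℝ (Poly n)} (Λ : Module.Dual ℝ ↥(E * E))
    (L : Submodule ℝ (Poly n)) (B' : List (Poly n)) : Prop :=
  (∀ b ∈ B', b ∈ L ∧ formAt Λ (b * b) ≠ 0) ∧
  B'.Pairwise (fun b c => formAt Λ (b * c) = 0) ∧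
  ∀ p ∈ L, (∀ b ∈ B', formAt Λ (p * b) = 0) → formAt Λ (p * p) = 0

/-- The states `(B, s)` that a run of the Decomposition algorithm on `(E, Λ)` can reach at the
head of its loop: it starts with `B = {1}`, `s = 1`, and while `s > 0` and `B⁺ ⊆ E` it chooses a
maximal orthogonal family `B'` in the span of the `b_{j,k}`, appends it to `B` and sets
`s = |B'|`. -/
inductive DecompState {n : ℕ} (E : Submodule ℝ (Poly n)) (Λ : Module.Dual ℝ ↥(E * E)) :
    List (Poly n) → ℕ → Prop
  | init : DecompState E Λ [1] 1
  | step {B : List (Poly n)} {s : ℕ} {B' : List (Poly n)} :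
      DecompState E Λ B s → 0 < s → prolong (spanList B) ≤ E →
      IsMaximalOrthogonal Λ (residualSpan Λ B) B' →
      DecompState E Λ (B ++ B') B'.length

/-- A run of the Decomposition algorithm on `(E, Λ)` stops with `success` and returns `B`: the
loop is left with `s = 0` and `B⁺ ⊆ E`. -/
def DecompositionSucceeds {n : ℕ} (E : Submodule ℝ (Poly n)) (Λ : Module.Dual ℝ ↥(E * E))
    (B : List (Poly n)) : Prop :=
  DecompState E Λ B 0 ∧ prolong (spanList B) ≤ E

end PolyOpt

end

/-!
Since the rank of the form `⟨p, q⟩ = Λ(pq)` does not grow from `⟨B⟩` to `W`, every element of `W`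
agrees with its projection to `⟨B⟩` modulo the kernel. Hence the compressions to `⟨B⟩` of the
multiplications by the `x_k` commute; they are symmetric, and a joint orthonormal eigenbasis gives
a quadrature formula `Λ(p) = ∑ᵢ wᵢ p(ξᵢ)` on `⟨W · W⟩` with positive weights and `r = |B|` nodes,
at which every interpolation problem is solvable in `⟨B⟩`.

Testing the positivity of `Λ` on Lagrange interpolants shows that the nodes satisfy the
constraints. As `Λ(f)` is at most the value of `f` at every feasible point and a weighted mean of
the values at the nodes, all nodes are minimizers. Conversely, the maximality of the rank forces
the kernel of the Hankel operator of `Λ` into that of the evaluation at any minimizer `x`. So the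
elements of `W` that vanish at the nodes vanish at `x`, and this makes `x` a node.

Thus `A_min` is the algebra of functions on the nodes. `B` is an orthogonal basis of it for the
form induced by `Λ`, which gives the matrices of the multiplication operators, and the indicator
functions of the nodes are their common eigenvectors.
-/

noncomputable section

namespace PolyOpt

open MvPolynomial Module

section LinearAlgebra

theorem exists_orthonormalBasis_jointEigenvectors {V : Type*} [NormedAddCommGroup V]
    [InnerProductSpace ℝ V] [FiniteDimensional ℝ V] {ι κ : Type*} [Fintype ι]
    (hι : Fintype.card ι = finrank ℝ V) (T : κ → V →ₗ[ℝ] V) (hT : ∀ k, (T k).IsSymmetric)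
    (hcomm : Pairwise fun k l => Commute (T k) (T l)) :
    ∃ (u : OrthonormalBasis ι ℝ V) (χ : ι → κ → ℝ), ∀ i k, T k (u i) = χ i k • u i := by
  classical
  let eigenspace : (κ → ℝ) → Submodule ℝ V := fun χ => ⨅ k, End.eigenspace (T k) (χ k)
  let Spectrum := {χ // eigenspace χ ≠ ⊥}
  have hint : DirectSum.IsInternal eigenspace :=
    LinearMap.IsSymmetric.directSum_isInternal_of_pairwise_commute hT hcomm
  have : Fintype Spectrum :=
    (WellFoundedGT.finite_ne_bot_of_iSupIndep hint.submodule_iSupIndep).fintype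
  have hint' : DirectSum.IsInternal fun χ : Spectrum => eigenspace χ :=
    (DirectSum.isInternal_ne_bot_iff).mpr hint
  have horth : OrthogonalFamily ℝ (fun χ : Spectrum => eigenspace χ)
      fun χ => (eigenspace χ).subtypeₗᵢ :=
    (LinearMap.IsSymmetric.orthogonalFamily_iInf_eigenspaces hT).comp Subtype.val_injective
  let u := hint'.subordinateOrthonormalBasis rfl horth
  let χ := fun i => (hint'.subordinateOrthonormalBasisIndex rfl i horth).1
  have hu : ∀ i k, T k (u i) = χ i k • u i := fun i k =>
    End.mem_eigenspace_iff.mp <|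
      (Submodule.mem_iInf _).mp (hint'.subordinateOrthonormalBasis_subordinate rfl i horth) k
  let e : Fin (finrank ℝ V) ≃ ι := (Fintype.equivFinOfCardEq hι).symm
  exact ⟨u.reindex e, χ ∘ e.symm, fun i k => by simpa using hu (e.symm i) k⟩

theorem apply_eq_sum_of_finrank_range_le {K V ι : Type*} [Field K] [AddCommGroup V] [Module K V]
    [Fintype ι] [DecidableEq ι] (A : V →ₗ[K] Dual K V) [FiniteDimensional K (LinearMap.range A)]
    {γ : ι → V} (hγ : ∀ i j, A (γ i) (γ j) = if i = j then 1 else 0)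
    (hrank : finrank K (LinearMap.range A) ≤ Fintype.card ι) (p q : V) :
    A p q = ∑ i, A p (γ i) * A (γ i) q := by
  have hcoeff : ∀ (c : ι → K) j, (∑ i, c i • A (γ i)) (γ j) = c j := fun c j => by
    simp [LinearMap.sum_apply, hγ]
  have hindep : LinearIndependent K fun i => A (γ i) := by
    refine Fintype.linearIndependent_iff.mpr fun c hc j => ?_
    rw [← hcoeff c j, hc, LinearMap.zero_apply]
  have hspan : Submodule.span K (Set.range fun i => A (γ i)) = LinearMap.range A := by
    refine Submodule.eq_of_le_of_finrank_le (Submodule.span_le.mpr ?_) ?_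
    · rintro _ ⟨i, rfl⟩
      exact LinearMap.mem_range_self A (γ i)
    · rwa [finrank_span_eq_card hindep]
  obtain ⟨c, hc⟩ : ∃ c : ι → K, ∑ i, c i • A (γ i) = A p :=
    (Submodule.mem_span_range_iff_exists_fun K).mp (hspan ▸ LinearMap.mem_range_self A p)
  have hcp : ∀ j, A p (γ j) = c j := fun j => hc ▸ hcoeff c j
  simp_rw [hcp, ← hc, LinearMap.sum_apply, LinearMap.smul_apply, smul_eq_mul]

section OrthogonalBasis

variable {K A ι : Type*} [Field K] [CommRing A] [Algebra K A] (form : A →ₗ[K] K)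
  (β : Basis ι K A)

theorem repr_eq_div_of_orthogonal (hne : ∀ i, form (β i * β i) ≠ 0)
    (horth : Pairwise fun i j => form (β i * β j) = 0) (a : A) (i : ι) :
    β.repr a i = form (β i * a) / form (β i * β i) := by
  have hsum : form (β i * a) = β.repr a i * form (β i * β i) := by
    have h := congrArg (fun a => form (β i * a)) (β.linearCombination_repr a)
    rw [← h]
    simp only [Finsupp.linearCombination_apply, Finsupp.sum, Finset.mul_sum, map_sum,
      mul_smul_comm, map_smul, smul_eq_mul]
    refine Finset.sum_eq_single i (fun j _ hji => ?_) fun hi => ?_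
    · rw [horth hji.symm, mul_zero]
    · rw [Finsupp.notMem_support_iff.mp hi, zero_mul]
  rw [hsum, mul_div_cancel_right₀ _ (hne i)]

theorem toMatrix_mulLeft_eq_of_orthogonal [Fintype ι] [DecidableEq ι]
    (hne : ∀ i, form (β i * β i) ≠ 0) (horth : Pairwise fun i j => form (β i * β j) = 0)
    (a : A) :
    LinearMap.toMatrix β β (LinearMap.mulLeft K a) =
      Matrix.of fun i j => form (a * β i * β j) / form (β i * β i) := by
  ext i j
  rw [LinearMap.toMatrix_apply, LinearMap.mulLeft_apply,
    repr_eq_div_of_orthogonal form β hne horth, Matrix.of_apply, mul_left_comm, ← mul_assoc]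

end OrthogonalBasis

end LinearAlgebra

section Prolongation

variable {n : ℕ} {V W U : Submodule ℝ (Poly n)}

theorem X_mul_mem_prolong {p : Poly n} (hp : p ∈ V) (k : Fin n) : X k * p ∈ prolong V :=
  (le_sup_right : _ ≤ prolong V) <|
    Submodule.mem_iSup_of_mem k (Submodule.mem_map_of_mem (f := LinearMap.mulLeft ℝ (X k)) hp)

theorem prolong_mono (h : V ≤ W) : prolong V ≤ prolong W :=
  sup_le_sup h (iSup_mono fun _ => Submodule.map_mono h)

theorem ConnectedToOne.one_mem (hW : ConnectedToOne W) : (1 : Poly n) ∈ W := by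
  obtain ⟨c, hc₀, hmono, -, N, rfl⟩ := hW
  exact hmono (Nat.zero_le N) (hc₀ ▸ Submodule.mem_span_singleton_self 1)

theorem ConnectedToOne.le_of_X_mul_mem (hW : ConnectedToOne W) (h1 : (1 : Poly n) ∈ U)
    (hX : ∀ p ∈ W, p ∈ U → ∀ k, X k * p ∈ U) : W ≤ U := by
  obtain ⟨c, hc₀, hmono, hstep, N, rfl⟩ := hW
  suffices hle : ∀ i ≤ N, c i ≤ U from hle N le_rfl
  intro i hi
  induction i with
  | zero => simpa [hc₀] using h1
  | succ i ih =>
    have hiU : c i ≤ U := ih (by omega)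
    have hiN : c i ≤ c N := hmono (by omega)
    refine (hstep i).trans (sup_le hiU (iSup_le fun k => ?_))
    rintro _ ⟨p, hp, rfl⟩
    exact hX p (hiN hp) (hiU hp) k

end Prolongation

section Quadrature

variable {n : ℕ} {ι : Type*}

/-- The algebra homomorphism `p ↦ (p(ξᵢ))ᵢ`. -/
def evalAt (ξ : ι → Fin n → ℝ) : Poly n →ₐ[ℝ] ι → ℝ :=
  AlgHom.pi fun i => aeval (ξ i)

@[simp]
theorem evalAt_apply (ξ : ι → Fin n → ℝ) (p : Poly n) (i : ι) : evalAt ξ p i = eval (ξ i) p := by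
  simp [evalAt]

/-- A positive quadrature formula `φ(p) = ∑ᵢ wᵢ p(ξᵢ)`, exact on `U`, for whose nodes every
interpolation problem has a solution in `V`. -/
structure IsInterpolatoryQuadrature [Fintype ι] (φ : Poly n → ℝ) (U V : Submodule ℝ (Poly n))
    (ξ : ι → Fin n → ℝ) (w : ι → ℝ) : Prop where
  weight_pos : ∀ i, 0 < w i
  apply_eq : ∀ p ∈ U, φ p = ∑ i, w i * eval (ξ i) p
  exists_interpolant : ∀ y : ι → ℝ, ∃ p ∈ V, evalAt ξ p = y

end Quadrature

section FlatOrthonormal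

variable {n : ℕ} {ι : Type*} {L : Poly n →ₗ[ℝ] ℝ} {W : Submodule ℝ (Poly n)}
  {β : ι → Poly n}

/-- The coordinates `(L(p βᵢ))ᵢ` of the orthogonal projection of `p` to the span of `β`. -/
def coordMap (L : Poly n →ₗ[ℝ] ℝ) (β : ι → Poly n) : Poly n →ₗ[ℝ] EuclideanSpace ℝ ι :=
  (WithLp.linearEquiv 2 ℝ (ι → ℝ)).symm.toLinearMap ∘ₗ
    LinearMap.pi fun i => L ∘ₗ LinearMap.mulRight ℝ (β i)

theorem coordMap_apply (p : Poly n) (i : ι) : coordMap L β p i = L (p * β i) := by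
  simp [coordMap]

variable [Fintype ι]

/-- The polynomial `∑ᵢ vᵢ βᵢ` with coordinate vector `v`. -/
def combination (β : ι → Poly n) : EuclideanSpace ℝ ι →ₗ[ℝ] Poly n :=
  Fintype.linearCombination ℝ β ∘ₗ (WithLp.linearEquiv 2 ℝ (ι → ℝ)).toLinearMap

/-- The compression to the span of `β` of the multiplication by `x_k`, in coordinates. -/
def compressedMul (L : Poly n →ₗ[ℝ] ℝ) (β : ι → Poly n) (k : Fin n) :
    EuclideanSpace ℝ ι →ₗ[ℝ] EuclideanSpace ℝ ι :=
  coordMap L β ∘ₗ LinearMap.mulLeft ℝ (X k) ∘ₗ combination β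

theorem combination_apply (v : EuclideanSpace ℝ ι) : combination β v = ∑ i, v i • β i := by
  simp [combination, Fintype.linearCombination_apply]

theorem compressedMul_apply (k : Fin n) (v : EuclideanSpace ℝ ι) :
    compressedMul L β k v = coordMap L β (X k * combination β v) :=
  rfl

theorem combination_mem_span (v : EuclideanSpace ℝ ι) :
    combination β v ∈ Submodule.span ℝ (Set.range β) := by
  rw [combination_apply]
  exact Submodule.sum_mem _ fun i _ =>
    Submodule.smul_mem _ _ (Submodule.subset_span (Set.mem_range_self i))

theorem inner_coordMap_left (p : Poly n) (v : EuclideanSpace ℝ ι) :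
    inner ℝ (coordMap L β p) v = L (p * combination β v) := by
  rw [PiLp.inner_apply, combination_apply, Finset.mul_sum, map_sum]
  simp [coordMap_apply]

theorem isSymmetric_compressedMul (k : Fin n) : (compressedMul L β k).IsSymmetric := fun v w => by
  rw [compressedMul_apply, inner_coordMap_left, real_inner_comm, compressedMul_apply,
    inner_coordMap_left]
  congr 1
  ring

/-- The family `β` is orthonormal for `⟨p, q⟩ = L(pq)`, its prolongation lies in `W`, and it
satisfies Parseval's identity on `W`. The last condition expresses flatness: `⟨p, q⟩` has on `W`
the same rank as on the span of `β`. -/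
structure IsFlatOrthonormal [DecidableEq ι] (L : Poly n →ₗ[ℝ] ℝ) (W : Submodule ℝ (Poly n))
    (β : ι → Poly n) : Prop where
  prolong_le : prolong (Submodule.span ℝ (Set.range β)) ≤ W
  apply_mul : ∀ i j, L (β i * β j) = if i = j then 1 else 0
  parseval : ∀ p ∈ W, ∀ q ∈ W, L (p * q) = ∑ i, L (p * β i) * L (q * β i)

namespace IsFlatOrthonormal

variable [DecidableEq ι]

theorem combination_mem (hβ : IsFlatOrthonormal L W β) (v : EuclideanSpace ℝ ι) :
    combination β v ∈ W :=
  hβ.prolong_le (le_prolong _ (combination_mem_span v))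

theorem X_mul_combination_mem (hβ : IsFlatOrthonormal L W β) (k : Fin n) (v : EuclideanSpace ℝ ι) :
    X k * combination β v ∈ W :=
  hβ.prolong_le (X_mul_mem_prolong (combination_mem_span v) k)

theorem coordMap_combination (hβ : IsFlatOrthonormal L W β) (v : EuclideanSpace ℝ ι) :
    coordMap L β (combination β v) = v := by
  ext i
  rw [coordMap_apply, combination_apply, Finset.sum_mul, map_sum]
  simp [hβ.apply_mul]

theorem inner_coordMap (hβ : IsFlatOrthonormal L W β) {p q : Poly n} (hp : p ∈ W) (hq : q ∈ W) :
    inner ℝ (coordMap L β p) (coordMap L β q) = L (p * q) := by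
  rw [hβ.parseval p hp q hq, PiLp.inner_apply]
  simp [coordMap_apply, mul_comm]

theorem coordMap_X_mul (hβ : IsFlatOrthonormal L W β) {p : Poly n} (hp : p ∈ W) (k : Fin n) :
    coordMap L β (X k * p) = compressedMul L β k (coordMap L β p) := by
  refine ext_inner_right ℝ fun v => ?_
  calc inner ℝ (coordMap L β (X k * p)) v
      = L (p * (X k * combination β v)) := by rw [inner_coordMap_left]; congr 1; ring
    _ = inner ℝ (coordMap L β p) (compressedMul L β k v) :=
        (hβ.inner_coordMap hp (hβ.X_mul_combination_mem k v)).symm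
    _ = inner ℝ (compressedMul L β k (coordMap L β p)) v :=
        (isSymmetric_compressedMul k _ _).symm

theorem commute_compressedMul (hβ : IsFlatOrthonormal L W β) (k l : Fin n) :
    Commute (compressedMul L β k) (compressedMul L β l) := by
  refine LinearMap.ext fun v => ?_
  simp only [Module.End.mul_apply, compressedMul_apply _ v,
    ← hβ.coordMap_X_mul (hβ.X_mul_combination_mem _ v), mul_left_comm (X k : Poly n)]

theorem inner_coordMap_eigenvector (hβ : IsFlatOrthonormal L W β) (hW : ConnectedToOne W)
    {u : EuclideanSpace ℝ ι} {χ : Fin n → ℝ} (hu : ∀ k, compressedMul L β k u = χ k • u)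
    {p : Poly n} (hp : p ∈ W) :
    inner ℝ (coordMap L β p) u = eval χ p * inner ℝ (coordMap L β 1) u := by
  let a := inner ℝ (coordMap L β 1) u
  let U : Submodule ℝ (Poly n) :=
    LinearMap.eqLocus ((innerₗ _ u) ∘ₗ coordMap L β) (a • (aeval χ).toLinearMap)
  have hU : ∀ q, q ∈ U ↔ inner ℝ (coordMap L β q) u = eval χ q * a := fun q => by
    simp [U, LinearMap.mem_eqLocus, real_inner_comm, mul_comm]
  refine (hU p).mp (hW.le_of_X_mul_mem ((hU 1).mpr (by simp [a])) (fun q hqW hq k => ?_) hp)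
  rw [hU] at hq ⊢
  rw [hβ.coordMap_X_mul hqW, isSymmetric_compressedMul, hu, inner_smul_right, hq, map_mul, eval_X,
    mul_assoc]

theorem exists_quadrature (hβ : IsFlatOrthonormal L W β) (hW : ConnectedToOne W) :
    ∃ (ξ : ι → Fin n → ℝ) (w : ι → ℝ),
      IsInterpolatoryQuadrature L (W * W) (Submodule.span ℝ (Set.range β)) ξ w := by
  obtain ⟨u, ξ, hu⟩ := exists_orthonormalBasis_jointEigenvectors (finrank_euclideanSpace).symm
    (compressedMul L β) isSymmetric_compressedMul fun k l _ => hβ.commute_compressedMul k l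
  let a : ι → ℝ := fun i => inner ℝ (coordMap L β 1) (u i)
  have hcoord : ∀ p ∈ W, ∀ i, inner ℝ (coordMap L β p) (u i) = eval (ξ i) p * a i :=
    fun p hp i => hβ.inner_coordMap_eigenvector hW (hu i) hp
  have ha : ∀ i, a i ≠ 0 := fun i hi => by
    have h := hcoord _ (hβ.combination_mem (u i)) i
    rw [hβ.coordMap_combination, hi, mul_zero, inner_self_eq_zero] at h
    exact u.orthonormal.ne_zero i h
  refine ⟨ξ, fun i => a i ^ 2, fun i => sq_pos_of_ne_zero (ha i), fun p hp => ?_, fun y => ?_⟩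
  · induction hp using Submodule.mul_induction_on' with
    | mem_mul_mem p hp q hq =>
      rw [← hβ.inner_coordMap hp hq, ← u.sum_inner_mul_inner]
      refine Finset.sum_congr rfl fun i _ => ?_
      rw [hcoord p hp, real_inner_comm, hcoord q hq, map_mul]
      ring
    | add p _ q _ hp hq => simp only [map_add, hp, hq, mul_add, Finset.sum_add_distrib]
  · let v := ∑ i, (y i * a i) • u i
    refine ⟨combination β v, combination_mem_span v, funext fun i => ?_⟩
    have h := hcoord _ (hβ.combination_mem v) i
    rw [hβ.coordMap_combination, real_inner_comm] at h
    rw [evalAt_apply]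
    refine mul_right_cancel₀ (ha i) (h.symm.trans ?_)
    simp [v, inner_sum, inner_smul_right, orthonormal_iff_ite.mp u.orthonormal]

end IsFlatOrthonormal

end FlatOrthonormal

section Forms

variable {n : ℕ}

theorem formAt_of_mem {U : Submodule ℝ (Poly n)} (Λ : Dual ℝ U) {p : Poly n} (hp : p ∈ U) :
    formAt Λ p = Λ ⟨p, hp⟩ :=
  dif_pos hp

theorem formAt_add {U : Submodule ℝ (Poly n)} (Λ Λ' : Dual ℝ U) (p : Poly n) :
    formAt (Λ + Λ') p = formAt Λ p + formAt Λ' p := by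
  by_cases hp : p ∈ U <;> simp [formAt, hp]

theorem formAt_smul {U : Submodule ℝ (Poly n)} (a : ℝ) (Λ : Dual ℝ U) (p : Poly n) :
    formAt (a • Λ) p = a * formAt Λ p := by
  by_cases hp : p ∈ U <;> simp [formAt, hp]

theorem exists_linearMap_eq_formAt {U : Submodule ℝ (Poly n)} (Λ : Dual ℝ U) :
    ∃ L : Poly n →ₗ[ℝ] ℝ, ∀ p ∈ U, formAt Λ p = L p := by
  obtain ⟨L, hL⟩ := LinearMap.exists_extend Λ
  exact ⟨L, fun p hp => by rw [formAt_of_mem Λ hp, ← hL]; rfl⟩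

variable {E W : Submodule ℝ (Poly n)} {G : Constraints n}

theorem formAt_restrictForm (hWE : W ≤ E) (Λ : Dual ℝ ↥(E * E)) {p : Poly n} (hp : p ∈ W * W) :
    formAt (restrictForm hWE Λ) p = formAt Λ p := by
  rw [formAt_of_mem _ hp, formAt_of_mem Λ (mul_le_mul' hWE hWE hp)]
  rfl

theorem hankel_apply (Λ : Dual ℝ ↥(E * E)) (p q : E) : hankel E Λ p q = formAt Λ (p * q) :=
  (formAt_of_mem Λ (Submodule.mul_mem_mul p.2 q.2)).symm

/-- The evaluation at `x` as a linear form on `⟨E · E⟩`. -/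
def evalForm (E : Submodule ℝ (Poly n)) (x : Fin n → ℝ) : Dual ℝ ↥(E * E) :=
  (aeval x).toLinearMap ∘ₗ (E * E).subtype

theorem formAt_evalForm (x : Fin n → ℝ) {p : Poly n} (hp : p ∈ E * E) :
    formAt (evalForm E x) p = eval x p := by
  rw [formAt_of_mem _ hp]
  simp [evalForm]

theorem eval_nonneg_of_mem_sumSquares (x : Fin n → ℝ) {p : Poly n} (hp : p ∈ sumSquares E) :
    0 ≤ eval x p := by
  induction hp using AddSubmonoid.closure_induction with
  | mem p hp =>
    obtain ⟨e, -, rfl⟩ := hp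
    rw [map_pow]
    exact sq_nonneg _
  | zero => simp
  | add p q _ _ hp hq => simpa using add_nonneg hp hq

theorem eval_nonneg_of_mem_quadModule {x : Fin n → ℝ} (hx : x ∈ G.feasible) {p : Poly n}
    (hp : p ∈ quadModule E G) : 0 ≤ eval x p := by
  obtain ⟨s, t, h, σ, hs, ht, -, hσ, rfl⟩ := hp
  have hzero : ∀ g ∈ s, eval x (g * h g) = 0 := fun g hg => by
    rw [map_mul, hx.1 g (hs hg), zero_mul]
  have hnonneg : ∀ g ∈ t, 0 ≤ eval x (g * σ g) := fun g hg => by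
    rw [map_mul]
    refine mul_nonneg ?_ (eval_nonneg_of_mem_sumSquares x (hσ g hg).1)
    rcases ht hg with rfl | hg
    · simp
    · exact hx.2 g hg
  rw [map_add, map_sum, map_sum, Finset.sum_eq_zero hzero, zero_add]
  exact Finset.sum_nonneg hnonneg

theorem quadModule_subset_mul : quadModule E G ⊆ (E * E : Submodule ℝ (Poly n)) := by
  rintro _ ⟨s, t, h, σ, -, -, hh, hσ, rfl⟩
  exact add_mem (sum_mem fun g hg => (hh g hg).2) (sum_mem fun g hg => (hσ g hg).2)

theorem evalForm_mem_dualCone (h1 : (1 : Poly n) ∈ E * E) {x : Fin n → ℝ}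
    (hx : x ∈ G.feasible) : evalForm E x ∈ dualCone E G := by
  refine ⟨fun p hp => ?_, by rw [formAt_evalForm x h1, map_one]⟩
  rw [formAt_evalForm x (quadModule_subset_mul hp)]
  exact eval_nonneg_of_mem_quadModule hx hp

theorem convex_dualCone : Convex ℝ (dualCone E G) := by
  rintro Λ ⟨hΛ, hΛ1⟩ Λ' ⟨hΛ', hΛ'1⟩ a b ha hb hab
  refine ⟨fun p hp => ?_, ?_⟩
  · rw [formAt_add, formAt_smul, formAt_smul]
    exact add_nonneg (mul_nonneg ha (hΛ p hp)) (mul_nonneg hb (hΛ' p hp))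
  · rw [formAt_add, formAt_smul, formAt_smul, hΛ1, hΛ'1, mul_one, mul_one, hab]

variable {Λ Λ' : Dual ℝ ↥(E * E)}

theorem formAt_mul_nonneg_of_mem_nonnegs (hΛ : Λ ∈ dualCone E G) {g v : Poly n}
    (hg : g ∈ insert 1 G.nonnegs) (hv : v ∈ E) (hgv : g * (v * v) ∈ E * E) :
    0 ≤ formAt Λ (g * (v * v)) :=
  have hsq : v * v ∈ sumSquares E := AddSubmonoid.subset_closure ⟨v, hv, (sq v).symm⟩
  hΛ.1 _ ⟨∅, {g}, 0, fun _ => v * v, by simp, by simpa using hg, by simp,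
    by simpa using ⟨hsq, hgv⟩, by simp⟩

theorem formAt_mul_self_nonneg (hΛ : Λ ∈ dualCone E G) {v : Poly n} (hv : v ∈ E) :
    0 ≤ formAt Λ (v * v) := by
  simpa using formAt_mul_nonneg_of_mem_nonnegs hΛ (Set.mem_insert 1 _) hv
    (by simpa using Submodule.mul_mem_mul hv hv)

theorem formAt_mul_nonneg_of_mem_eqs (hΛ : Λ ∈ dualCone E G) {g v : Poly n} (hg : g ∈ G.eqs)
    (hv : v ∈ E) (hgv : g * v ∈ E * E) : 0 ≤ formAt Λ (g * v) :=
  hΛ.1 _ ⟨{g}, ∅, fun _ => v, 0, by simpa using hg, by simp, by simpa using ⟨hv, hgv⟩,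
    by simp, by simp⟩

theorem formAt_mul_eq_zero_of_mem_eqs (hΛ : Λ ∈ dualCone E G) {g v : Poly n} (hg : g ∈ G.eqs)
    (hv : v ∈ E) (hgv : g * v ∈ E * E) : formAt Λ (g * v) = 0 := by
  obtain ⟨L, hL⟩ := exists_linearMap_eq_formAt Λ
  have hgv' : g * -v ∈ E * E := by simpa using hgv
  have hneg := formAt_mul_nonneg_of_mem_eqs hΛ hg (neg_mem hv) hgv'
  rw [hL _ hgv', mul_neg, map_neg, ← hL _ hgv, Left.nonneg_neg_iff] at hneg
  exact hneg.antisymm (formAt_mul_nonneg_of_mem_eqs hΛ hg hv hgv)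

theorem mem_ker_hankel_iff (hΛ : Λ ∈ dualCone E G) (p : E) :
    p ∈ LinearMap.ker (hankel E Λ) ↔ formAt Λ (p * p) = 0 := by
  have hnonneg : ∀ q, 0 ≤ hankel E Λ q q := fun q => by
    rw [hankel_apply]
    exact formAt_mul_self_nonneg hΛ q.2
  have hsymm : (hankel E Λ).IsSymm :=
    ⟨fun q s => by simp only [hankel_apply, mul_comm, RingHom.id_apply]⟩
  rw [← hankel_apply]
  exact (LinearMap.BilinForm.apply_apply_same_eq_zero_iff (hankel E Λ) hnonneg hsymm).symm

theorem IsOptimalForm.ker_hankel_le [FiniteDimensional ℝ E] {f : Poly n}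
    (hΛ : IsOptimalForm f E G Λ) (hΛ' : Λ' ∈ dualCone E G) (hf : formAt Λ' f = formAt Λ f) :
    LinearMap.ker (hankel E Λ) ≤ LinearMap.ker (hankel E Λ') := by
  obtain ⟨hmem, hopt, hmax⟩ := hΛ
  -- The kernel for the midpoint `M` lies in both kernels, and it is not smaller than that of `Λ`
  -- because `M` is a minimizer as well, so its Hankel operator has no larger rank.
  let M : Dual ℝ ↥(E * E) := (1 / 2 : ℝ) • Λ + (1 / 2 : ℝ) • Λ'
  have hM : ∀ p, formAt M p = 1 / 2 * formAt Λ p + 1 / 2 * formAt Λ' p := fun p => by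
    rw [formAt_add, formAt_smul, formAt_smul]
  have hMmem : M ∈ dualCone E G :=
    convex_dualCone hmem hΛ' (by norm_num) (by norm_num) (by norm_num)
  have hMf : formAt M f = formAt Λ f := by rw [hM, hf]; ring
  have hker : LinearMap.ker (hankel E M) ≤
      LinearMap.ker (hankel E Λ) ⊓ LinearMap.ker (hankel E Λ') := by
    intro p hp
    rw [Submodule.mem_inf, mem_ker_hankel_iff hmem, mem_ker_hankel_iff hΛ']
    rw [mem_ker_hankel_iff hMmem, hM] at hp
    have h := formAt_mul_self_nonneg hmem p.2
    have h' := formAt_mul_self_nonneg hΛ' p.2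
    constructor <;> linarith
  have hrank : finrank ℝ (LinearMap.ker (hankel E Λ)) ≤
      finrank ℝ (LinearMap.ker (hankel E M)) := by
    have hle : finrank ℝ (LinearMap.range (hankel E M)) ≤
        finrank ℝ (LinearMap.range (hankel E Λ)) := hmax M hMmem (hMf ▸ hopt)
    have := (hankel E Λ).finrank_range_add_finrank_ker
    have := (hankel E M).finrank_range_add_finrank_ker
    omega
  rw [← Submodule.eq_of_le_of_finrank_le (hker.trans inf_le_left) hrank]
  exact hker.trans inf_le_right

theorem IsOptimalForm.eval_eq_zero [FiniteDimensional ℝ E] {f : Poly n}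
    (hΛ : IsOptimalForm f E G Λ) (h1 : (1 : Poly n) ∈ E * E) (hf : f ∈ E * E) {x : Fin n → ℝ}
    (hx : x ∈ G.feasible) (hfx : eval x f = formAt Λ f) {p : Poly n} (hp : p ∈ E)
    (hpp : formAt Λ (p * p) = 0) : eval x p = 0 := by
  have hxmem : evalForm E x ∈ dualCone E G := evalForm_mem_dualCone h1 hx
  have hker := hΛ.ker_hankel_le hxmem ((formAt_evalForm x hf).trans hfx)
    ((mem_ker_hankel_iff hΛ.1 ⟨p, hp⟩).mpr hpp)
  rw [mem_ker_hankel_iff hxmem, formAt_evalForm x (Submodule.mul_mem_mul hp hp), map_mul] at hker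
  exact mul_self_eq_zero.mp hker

theorem IsOptimalForm.formAt_le_eval {f : Poly n} (hΛ : IsOptimalForm f E G Λ)
    (h1 : (1 : Poly n) ∈ E * E) (hf : f ∈ E * E) {x : Fin n → ℝ} (hx : x ∈ G.feasible) :
    formAt Λ f ≤ eval x f := by
  have h := iInf₂_le (f := fun Λ (_ : Λ ∈ dualCone E G) => ((formAt Λ f : ℝ) : EReal)) _
    (evalForm_mem_dualCone h1 hx)
  rw [formAt_evalForm x hf] at h
  exact EReal.coe_le_coe_iff.mp (hΛ.2.1.trans_le h)

end Forms

section FlatExtension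

variable {n : ℕ} {ι : Type*} [Fintype ι] {V W : Submodule ℝ (Poly n)} {Λ : Dual ℝ ↥(W * W)}

theorem IsFlatExtension.isFlatOrthonormal [DecidableEq ι] [FiniteDimensional ℝ W]
    {hVW : V ≤ W} (hflat : IsFlatExtension hVW Λ) (hprolong : prolong V ≤ W)
    (hV : finrank ℝ V ≤ Fintype.card ι) {L : Poly n →ₗ[ℝ] ℝ}
    (hL : ∀ p ∈ W * W, formAt Λ p = L p) {β : ι → Poly n} (hβV : ∀ i, β i ∈ V)
    (hβ : ∀ i j, L (β i * β j) = if i = j then 1 else 0) : IsFlatOrthonormal L W β := by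
  have : FiniteDimensional ℝ V := Submodule.finiteDimensional_of_le hVW
  have hspan : Submodule.span ℝ (Set.range β) ≤ V :=
    Submodule.span_le.mpr (Set.range_subset_iff.mpr hβV)
  have hhankel : ∀ p q : W, hankel W Λ p q = L (p * q) := fun p q => by
    rw [hankel_apply, hL _ (Submodule.mul_mem_mul p.2 q.2)]
  have hrank : finrank ℝ (LinearMap.range (hankel W Λ)) ≤ Fintype.card ι :=
    (hflat.le.trans (LinearMap.finrank_range_le _)).trans hV
  refine ⟨(prolong_mono hspan).trans hprolong, hβ, fun p hp q hq => ?_⟩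
  have h := apply_eq_sum_of_finrank_range_le (hankel W Λ) (γ := fun i => ⟨β i, hVW (hβV i)⟩)
    (fun i j => (hhankel _ _).trans (hβ i j)) hrank ⟨p, hp⟩ ⟨q, hq⟩
  simpa only [hhankel, mul_comm (β _) q] using h

theorem IsFlatExtension.exists_quadrature [FiniteDimensional ℝ W] (hW : ConnectedToOne W)
    {b : ι → Poly n} (hbW : prolong (Submodule.span ℝ (Set.range b)) ≤ W)
    (hflat : IsFlatExtension ((le_prolong _).trans hbW) Λ)
    (hpos : ∀ i, 0 < formAt Λ (b i * b i))
    (horth : Pairwise fun i j => formAt Λ (b i * b j) = 0) :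
    ∃ (ξ : ι → Fin n → ℝ) (w : ι → ℝ),
      IsInterpolatoryQuadrature (formAt Λ) (W * W) (Submodule.span ℝ (Set.range b)) ξ w := by
  classical
  obtain ⟨L, hL⟩ := exists_linearMap_eq_formAt Λ
  let β : ι → Poly n := fun i => (√(formAt Λ (b i * b i)))⁻¹ • b i
  have hb : ∀ i, b i ∈ Submodule.span ℝ (Set.range b) := fun i =>
    Submodule.subset_span (Set.mem_range_self i)
  have hβ : ∀ i, β i ∈ Submodule.span ℝ (Set.range b) := fun i => Submodule.smul_mem _ _ (hb i)
  have hLb : ∀ i j, L (b i * b j) = formAt Λ (b i * b j) := fun i j =>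
    (hL _ (Submodule.mul_mem_mul (hbW (le_prolong _ (hb i))) (hbW (le_prolong _ (hb j))))).symm
  have hβorth : ∀ i j, L (β i * β j) = if i = j then 1 else 0 := fun i j => by
    rw [smul_mul_smul_comm, map_smul, hLb, smul_eq_mul]
    split_ifs with hij
    · rw [← hij, ← mul_inv, Real.mul_self_sqrt (hpos i).le, inv_mul_cancel₀ (hpos i).ne']
    · rw [horth hij, mul_zero]
  obtain ⟨ξ, w, hq⟩ := (hflat.isFlatOrthonormal hbW (finrank_range_le_card b) hL hβ
    hβorth).exists_quadrature hW
  refine ⟨ξ, w, hq.weight_pos, fun p hp => (hL p hp).trans (hq.apply_eq p hp), fun y => ?_⟩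
  obtain ⟨p, hp, hpy⟩ := hq.exists_interpolant y
  exact ⟨p, Submodule.span_le.mpr (Set.range_subset_iff.mpr hβ) hp, hpy⟩

theorem exists_quadrature_of_isFlatExtension_restrictForm {E : Submodule ℝ (Poly n)}
    [FiniteDimensional ℝ E] {G : Constraints n} {Λ : Dual ℝ ↥(E * E)} (hΛ : Λ ∈ dualCone E G)
    (hWE : W ≤ E) (hW : ConnectedToOne W) {b : ι → Poly n}
    (hbW : prolong (Submodule.span ℝ (Set.range b)) ≤ W)
    (hflat : IsFlatExtension ((le_prolong _).trans hbW) (restrictForm hWE Λ))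
    (hne : ∀ i, formAt Λ (b i * b i) ≠ 0)
    (horth : Pairwise fun i j => formAt Λ (b i * b j) = 0) :
    ∃ (ξ : ι → Fin n → ℝ) (w : ι → ℝ),
      IsInterpolatoryQuadrature (formAt Λ) (W * W) (Submodule.span ℝ (Set.range b)) ξ w := by
  have : FiniteDimensional ℝ W := Submodule.finiteDimensional_of_le hWE
  have hb : ∀ i, b i ∈ W := fun i =>
    hbW (le_prolong _ (Submodule.subset_span (Set.mem_range_self i)))
  have hrestrict : ∀ i j, formAt (restrictForm hWE Λ) (b i * b j) = formAt Λ (b i * b j) :=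
    fun i j => formAt_restrictForm hWE Λ (Submodule.mul_mem_mul (hb i) (hb j))
  have hpos : ∀ i, 0 < formAt (restrictForm hWE Λ) (b i * b i) := fun i => by
    rw [hrestrict]
    exact (formAt_mul_self_nonneg hΛ (hWE (hb i))).lt_of_ne' (hne i)
  obtain ⟨ξ, w, hq⟩ := hflat.exists_quadrature hW hbW hpos fun i j hij =>
    (hrestrict i j).trans (horth hij)
  exact ⟨ξ, w, { hq with
    apply_eq := fun p hp => (formAt_restrictForm hWE Λ hp).symm.trans (hq.apply_eq p hp) }⟩

end FlatExtension

section Decomposition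

theorem sum_map_mul_eq_of_pairwise {α R : Type*} [NonUnitalNonAssocSemiring R] {φ : α → α → R}
    (hφ : ∀ x y, φ x y = φ y x) (a : α → R) {B : List α} (hB : B.Pairwise fun x y => φ x y = 0)
    {c : α} (hc : c ∈ B) : (B.map fun x => a x * φ x c).sum = a c * φ c c := by
  induction B with
  | nil => simp at hc
  | cons d B ih =>
    rw [List.pairwise_cons] at hB
    rw [List.map_cons, List.sum_cons]
    rcases List.mem_cons.mp hc with rfl | hc
    · have hzero : ∀ y ∈ B.map fun x => a x * φ x c, y = 0 := fun y hy => by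
        obtain ⟨x, hx, rfl⟩ := List.mem_map.mp hy
        rw [hφ, hB.1 x hx, mul_zero]
      rw [List.sum_eq_zero hzero, add_zero]
    · rw [ih hB.2 hc, hB.1 c hc, mul_zero, zero_add]

variable {n : ℕ} {E : Submodule ℝ (Poly n)} {Λ : Dual ℝ ↥(E * E)} {B : List (Poly n)}

theorem mem_of_prolong_spanList_le (hBE : prolong (spanList B) ≤ E) {b : Poly n} (hb : b ∈ B) :
    b ∈ E :=
  hBE (le_prolong _ (Submodule.subset_span hb))

theorem X_mul_mem_of_prolong_spanList_le (hBE : prolong (spanList B) ≤ E) {b : Poly n}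
    (hb : b ∈ B) (k : Fin n) : X k * b ∈ E :=
  hBE (X_mul_mem_prolong (Submodule.subset_span hb) k)

theorem residualSpan_le (hBE : prolong (spanList B) ≤ E) : residualSpan Λ B ≤ E := by
  refine Submodule.span_le.mpr ?_
  rintro _ ⟨b, hb, k, rfl⟩
  refine sub_mem (X_mul_mem_of_prolong_spanList_le hBE hb k) (list_sum_mem fun y hy => ?_)
  obtain ⟨c, hc, rfl⟩ := List.mem_map.mp hy
  exact E.smul_mem _ (mem_of_prolong_spanList_le hBE hc)

theorem formAt_mul_eq_zero_of_mem_residualSpan (hBE : prolong (spanList B) ≤ E)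
    (hne : ∀ b ∈ B, formAt Λ (b * b) ≠ 0) (horth : B.Pairwise fun b c => formAt Λ (b * c) = 0)
    {p c : Poly n} (hp : p ∈ residualSpan Λ B) (hc : c ∈ B) : formAt Λ (p * c) = 0 := by
  obtain ⟨L, hL⟩ := exists_linearMap_eq_formAt Λ
  have hmul : ∀ q ∈ E, formAt Λ (q * c) = L (q * c) := fun q hq =>
    hL _ (Submodule.mul_mem_mul hq (mem_of_prolong_spanList_le hBE hc))
  suffices hle : residualSpan Λ B ≤ LinearMap.ker (L ∘ₗ LinearMap.mulRight ℝ c) by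
    rw [hmul p (residualSpan_le hBE hp)]
    exact hle hp
  refine Submodule.span_le.mpr ?_
  rintro _ ⟨b, hb, k, rfl⟩
  let coeff : Poly n → ℝ := fun d => formAt Λ (X k * b * d) / formAt Λ (d * d)
  have hproj : L ((B.map fun d => coeff d • d).sum * c) = formAt Λ (X k * b * c) := by
    calc L ((B.map fun d => coeff d • d).sum * c)
        = (B.map fun d => coeff d * L (d * c)).sum := by
          rw [← List.sum_map_mul_right, map_list_sum, List.map_map]
          simp only [Function.comp_def, smul_mul_assoc, map_smul, smul_eq_mul]
      _ = (B.map fun d => coeff d * formAt Λ (d * c)).sum :=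
          congrArg List.sum <| List.map_congr_left fun d hd => by
            rw [hmul d (mem_of_prolong_spanList_le hBE hd)]
      _ = coeff c * formAt Λ (c * c) :=
          sum_map_mul_eq_of_pairwise (φ := fun b c => formAt Λ (b * c))
            (fun b c => by rw [mul_comm b]) coeff horth hc
      _ = formAt Λ (X k * b * c) := div_mul_cancel₀ _ (hne c hc)
  change L ((X k * b - (B.map fun d => coeff d • d).sum) * c) = 0
  rw [sub_mul, map_sub, hproj, hmul _ (X_mul_mem_of_prolong_spanList_le hBE hb k), sub_self]

theorem DecompState.orthogonal (h1 : formAt Λ 1 ≠ 0) {s : ℕ} (h : DecompState E Λ B s) :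
    (∀ b ∈ B, formAt Λ (b * b) ≠ 0) ∧ B.Pairwise fun b c => formAt Λ (b * c) = 0 := by
  induction h with
  | init => simpa using h1
  | step _ _ hBE hmax ih =>
    obtain ⟨hne, horth⟩ := ih
    refine ⟨fun b hb => ?_, List.pairwise_append.mpr ⟨horth, hmax.2.1, fun c hc b hb => ?_⟩⟩
    · exact (List.mem_append.mp hb).elim (hne b) fun hb => (hmax.1 b hb).2
    · rw [mul_comm c]
      exact formAt_mul_eq_zero_of_mem_residualSpan hBE hne horth (hmax.1 b hb).1 hc

theorem DecompState.pairwise_of_ofFn (h1 : formAt Λ 1 ≠ 0) {r s : ℕ} {b : Fin r → Poly n}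
    (h : DecompState E Λ (List.ofFn b) s) : Pairwise fun i j => formAt Λ (b i * b j) = 0 := by
  have hlt := List.pairwise_ofFn.mp (h.orthogonal h1).2
  intro i j hij
  rcases hij.lt_or_gt with hij | hji
  · exact hlt hij
  · rw [mul_comm (b i)]
    exact hlt hji

end Decomposition

section Nodes

variable {n : ℕ} {ι : Type*} [Fintype ι] {φ : Poly n → ℝ} {U V W : Submodule ℝ (Poly n)}
  {ξ : ι → Fin n → ℝ} {w : ι → ℝ}

namespace IsInterpolatoryQuadrature

theorem surjective_evalAt (hq : IsInterpolatoryQuadrature φ U V ξ w) :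
    Function.Surjective (evalAt ξ) := fun y =>
  (hq.exists_interpolant y).imp fun _ => And.right

theorem injective (hq : IsInterpolatoryQuadrature φ U V ξ w) : Function.Injective ξ := by
  classical
  intro i j hij
  obtain ⟨p, -, hp⟩ := hq.exists_interpolant (Pi.single i 1)
  have hpij : evalAt ξ p i = evalAt ξ p j := by rw [evalAt_apply, evalAt_apply, hij]
  by_contra hne
  rw [hp, Pi.single_eq_same, Pi.single_eq_of_ne' hne] at hpij
  exact one_ne_zero hpij

theorem apply_mul_of_evalAt_eq_single [DecidableEq ι]
    (hq : IsInterpolatoryQuadrature φ U V ξ w) {p ℓ : Poly n} {i : ι}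
    (hℓ : evalAt ξ ℓ = Pi.single i 1) (hpℓ : p * ℓ ∈ U) : φ (p * ℓ) = w i * eval (ξ i) p := by
  have hsingle : ∀ j, w j * eval (ξ j) (p * ℓ) = if i = j then w j * eval (ξ j) p else 0 :=
    fun j => by
      rw [map_mul, ← evalAt_apply ξ ℓ, hℓ, Pi.single_apply]
      simp [eq_comm]
  rw [hq.apply_eq _ hpℓ, Finset.sum_congr rfl fun j _ => hsingle j, Finset.sum_ite_eq,
    if_pos (Finset.mem_univ i)]

theorem sum_weight (hq : IsInterpolatoryQuadrature φ U V ξ w) (h1 : (1 : Poly n) ∈ U) :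
    ∑ i, w i = φ 1 := by
  simpa using (hq.apply_eq 1 h1).symm

theorem eval_node_eq (hq : IsInterpolatoryQuadrature φ U V ξ w) (h1 : (1 : Poly n) ∈ U)
    (hφ : φ 1 = 1) {f : Poly n} (hf : f ∈ U) (hle : ∀ i, φ f ≤ eval (ξ i) f) (i : ι) :
    eval (ξ i) f = φ f := by
  have hsum : ∑ i, w i * φ f = ∑ i, w i * eval (ξ i) f := by
    rw [← Finset.sum_mul, hq.sum_weight h1, hφ, one_mul, hq.apply_eq f hf]
  have heq := (Finset.sum_eq_sum_iff_of_le fun i _ =>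
    mul_le_mul_of_nonneg_left (hle i) (hq.weight_pos i).le).mp hsum i (Finset.mem_univ i)
  exact (mul_left_cancel₀ (hq.weight_pos i).ne' heq).symm

theorem mem_range_of_forall_eval_eq_zero (hq : IsInterpolatoryQuadrature φ U V ξ w)
    (hVW : prolong V ≤ W) (h1 : (1 : Poly n) ∈ W) {x : Fin n → ℝ}
    (hx : ∀ p ∈ W, evalAt ξ p = 0 → eval x p = 0) : x ∈ Set.range ξ := by
  classical
  choose ℓ hℓV hℓ using fun i => hq.exists_interpolant (Pi.single i 1)
  have hℓW : ∀ i, ℓ i ∈ W := fun i => hVW (le_prolong _ (hℓV i))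
  have hone : eval x (1 - ∑ i, ℓ i) = 0 := by
    refine hx _ (sub_mem h1 (sum_mem fun i _ => hℓW i)) ?_
    rw [map_sub, map_one, map_sum, Finset.sum_congr rfl fun i _ => hℓ i]
    exact sub_eq_zero.mpr (Finset.univ_sum_single 1).symm
  obtain ⟨i, hi⟩ : ∃ i, eval x (ℓ i) ≠ 0 := by
    by_contra! hzero
    simp [hzero] at hone
  refine ⟨i, funext fun k => ?_⟩
  have hcoord : eval x (X k * ℓ i - ξ i k • ℓ i) = 0 := by
    refine hx _ (sub_mem (hVW (X_mul_mem_prolong (hℓV i) k)) (W.smul_mem _ (hℓW i))) ?_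
    ext j
    rcases eq_or_ne j i with rfl | hji
    · simp [smul_eval]
    · simp only [map_sub, map_mul, map_smul, hℓ, Pi.sub_apply, Pi.mul_apply, Pi.smul_apply,
        Pi.single_eq_of_ne hji, mul_zero, smul_zero, sub_zero, Pi.zero_apply]
  rw [map_sub, map_mul, eval_X, smul_eval, ← sub_mul] at hcoord
  exact (sub_eq_zero.mp ((mul_eq_zero.mp hcoord).resolve_right hi)).symm

end IsInterpolatoryQuadrature

variable {f : Poly n} {E : Submodule ℝ (Poly n)} {G : Constraints n} {Λ : Dual ℝ ↥(E * E)}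

theorem node_mem_feasible (hΛ : Λ ∈ dualCone E G)
    (hq : IsInterpolatoryQuadrature (formAt Λ) U V ξ w) (hUE : U ≤ E * E) (hVE : V ≤ E)
    (hG₀ : ∀ g ∈ G.eqs, ∀ v ∈ V, g * v ∈ U)
    (hG₁ : ∀ g ∈ G.nonnegs, ∀ v ∈ V, ∀ v' ∈ V, g * (v * v') ∈ U) (i : ι) :
    ξ i ∈ G.feasible := by
  classical
  obtain ⟨ℓ, hℓV, hℓ⟩ := hq.exists_interpolant (Pi.single i 1)
  have hℓℓ : evalAt ξ (ℓ * ℓ) = Pi.single i 1 := by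
    rw [map_mul, hℓ, ← Pi.single_mul, one_mul]
  refine ⟨fun g hg => ?_, fun g hg => ?_⟩
  · have hgℓ := hG₀ g hg ℓ hℓV
    have h := formAt_mul_eq_zero_of_mem_eqs hΛ hg (hVE hℓV) (hUE hgℓ)
    rw [hq.apply_mul_of_evalAt_eq_single hℓ hgℓ] at h
    exact (mul_eq_zero.mp h).resolve_left (hq.weight_pos i).ne'
  · have hgℓ := hG₁ g hg ℓ hℓV ℓ hℓV
    have h := formAt_mul_nonneg_of_mem_nonnegs hΛ (Set.mem_insert_of_mem 1 hg) (hVE hℓV)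
      (hUE hgℓ)
    rw [hq.apply_mul_of_evalAt_eq_single hℓℓ hgℓ] at h
    exact nonneg_of_mul_nonneg_right h (hq.weight_pos i)

theorem IsOptimalForm.range_eq_minimizers [FiniteDimensional ℝ E] (hΛ : IsOptimalForm f E G Λ)
    (hWE : W ≤ E) (h1 : (1 : Poly n) ∈ W) (hf : f ∈ W * W) (hVW : prolong V ≤ W)
    (hq : IsInterpolatoryQuadrature (formAt Λ) (W * W) V ξ w) (hξ : ∀ i, ξ i ∈ G.feasible)
    {S : Set (Fin n → ℝ)} (hGS : G.feasible ⊆ S) (hSG : minimizers f S ⊆ G.feasible)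
    (hinf : IsGLB ((fun x => eval x f) '' S) (infValue f G.feasible)) :
    Set.range ξ = minimizers f S := by
  have hWWE : W * W ≤ E * E := mul_le_mul' hWE hWE
  have h11 : (1 : Poly n) ∈ W * W := by simpa using Submodule.mul_mem_mul h1 h1
  have hle : ∀ x ∈ G.feasible, formAt Λ f ≤ eval x f := fun x hx =>
    hΛ.formAt_le_eval (hWWE h11) (hWWE hf) hx
  have hnode : ∀ i, eval (ξ i) f = formAt Λ f :=
    hq.eval_node_eq h11 hΛ.1.2 hf fun i => hle _ (hξ i)
  obtain ⟨i₀⟩ : Nonempty ι := by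
    by_contra hempty
    rw [not_nonempty_iff] at hempty
    simpa [hΛ.1.2] using hq.sum_weight h11
  have hmin : infValue f S = formAt Λ f := by
    have hleast : IsLeast ((fun x => eval x f) '' G.feasible) (formAt Λ f) :=
      ⟨⟨ξ i₀, hξ i₀, hnode i₀⟩, Set.forall_mem_image.mpr hle⟩
    exact (hinf.csInf_eq ⟨_, ξ i₀, hGS (hξ i₀), rfl⟩).trans hleast.csInf_eq
  refine Set.Subset.antisymm ?_ fun x hx => ?_
  · rintro _ ⟨i, rfl⟩
    exact ⟨hGS (hξ i), (hnode i).trans hmin.symm⟩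
  · refine hq.mem_range_of_forall_eval_eq_zero hVW h1 fun p hp hpξ => ?_
    refine hΛ.eval_eq_zero (hWWE h11) (hWWE hf) (hSG hx) (hx.2.trans hmin) (hWE hp) ?_
    rw [hq.apply_eq _ (Submodule.mul_mem_mul hp hp)]
    simp [← evalAt_apply, hpξ]

end Nodes

section QuotientAlgebra

variable {n : ℕ} {ι : Type*} {ξ : ι → Fin n → ℝ} {I : Ideal (Poly n)}

theorem vanishingIdeal_range (ξ : ι → Fin n → ℝ) :
    vanishingIdeal ℝ (Set.range ξ) = RingHom.ker (evalAt ξ) := by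
  ext p
  rw [mem_vanishingIdeal_iff, Set.forall_mem_range, RingHom.mem_ker, funext_iff]
  simp

/-- The algebra of functions on the nodes `ξ` as the quotient of the polynomial ring by their
vanishing ideal, when all interpolation problems at `ξ` are solvable. The ideal is left variable
up to a propositional equality, so that it can be a minimizer ideal. -/
def quotientEquivNodes (hI : I = RingHom.ker (evalAt ξ)) (hξ : Function.Surjective (evalAt ξ)) :
    (Poly n ⧸ I) ≃ₐ[ℝ] ι → ℝ :=
  (Ideal.quotientEquivAlgOfEq ℝ hI).trans (Ideal.quotientKerAlgEquivOfSurjective hξ)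

theorem quotientEquivNodes_mk (hI : I = RingHom.ker (evalAt ξ))
    (hξ : Function.Surjective (evalAt ξ)) (p : Poly n) :
    quotientEquivNodes hI hξ (Ideal.Quotient.mk I p) = evalAt ξ p :=
  rfl

theorem exists_basis_quotient [Finite ι] (hI : I = RingHom.ker (evalAt ξ)) {b : ι → Poly n}
    (hb : ∀ y, ∃ p ∈ Submodule.span ℝ (Set.range b), evalAt ξ p = y) :
    ∃ β : Basis ι ℝ (Poly n ⧸ I), ∀ i, β i = Ideal.Quotient.mk I (b i) := by
  have : Fintype ι := Fintype.ofFinite ι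
  let e := quotientEquivNodes hI fun y => (hb y).imp fun _ => And.right
  have hspan : ⊤ ≤ Submodule.span ℝ (Set.range fun i => evalAt ξ (b i)) := fun y _ => by
    obtain ⟨p, hp, rfl⟩ := hb y
    have hmap := Submodule.mem_map_of_mem (f := (evalAt ξ).toLinearMap) hp
    rwa [Submodule.map_span, ← Set.range_comp] at hmap
  let β := basisOfTopLeSpanOfCardEqFinrank _ hspan (finrank_fintype_fun_eq_card ℝ).symm
  refine ⟨β.map e.symm.toLinearEquiv, fun i => ?_⟩
  change e.symm (β i) = _
  rw [e.symm_apply_eq, coe_basisOfTopLeSpanOfCardEqFinrank]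
  exact (quotientEquivNodes_mk hI _ (b i)).symm

theorem exists_linearIndependent_eigenvectors [Finite ι]
    (hI : I = RingHom.ker (evalAt ξ)) (hξ : Function.Surjective (evalAt ξ)) :
    ∃ u : ι → Poly n ⧸ I, LinearIndependent ℝ u ∧
      ∀ i p, Ideal.Quotient.mk I p * u i = eval (ξ i) p • u i := by
  classical
  let e := quotientEquivNodes hI hξ
  let u := (Pi.basisFun ℝ ι).map e.symm.toLinearEquiv
  refine ⟨u, u.linearIndependent, fun i p => e.injective ?_⟩
  have hu : e (u i) = Pi.single i 1 := by simp [u]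
  rw [map_mul, map_smul, hu, quotientEquivNodes_mk]
  ext j
  rcases eq_or_ne j i with rfl | hji
  · simp
  · simp [hji]

theorem IsInterpolatoryQuadrature.toMatrix_mulLeft [Fintype ι] [DecidableEq ι]
    {φ : Poly n → ℝ} {U V : Submodule ℝ (Poly n)} {w : ι → ℝ}
    (hq : IsInterpolatoryQuadrature φ U V ξ w) (hI : I = RingHom.ker (evalAt ξ))
    {b : ι → Poly n} {β : Basis ι ℝ (Poly n ⧸ I)} (hβ : ∀ i, β i = Ideal.Quotient.mk I (b i))
    (hbU : ∀ i j, b i * b j ∈ U) (hne : ∀ i, φ (b i * b i) ≠ 0)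
    (horth : Pairwise fun i j => φ (b i * b j) = 0) {p : Poly n} (hpU : ∀ i j, p * b i * b j ∈ U) :
    LinearMap.toMatrix β β (LinearMap.mulLeft ℝ (Ideal.Quotient.mk I p)) =
      Matrix.of fun i j => φ (p * b i * b j) / φ (b i * b i) := by
  let e := quotientEquivNodes hI hq.surjective_evalAt
  let form : (Poly n ⧸ I) →ₗ[ℝ] ℝ := (∑ i, w i • LinearMap.proj i) ∘ₗ e.toLinearMap
  have hform : ∀ q ∈ U, form (Ideal.Quotient.mk I q) = φ q := fun q hqU => by
    have happly : form (Ideal.Quotient.mk I q) = ∑ i, w i * e (Ideal.Quotient.mk I q) i := by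
      simp [form]
    simp only [happly, e, quotientEquivNodes_mk, evalAt_apply, hq.apply_eq q hqU]
  have hββ : ∀ i j, form (β i * β j) = φ (b i * b j) := fun i j => by
    rw [hβ, hβ, ← map_mul, hform _ (hbU i j)]
  rw [toMatrix_mulLeft_eq_of_orthogonal form β (fun i => hββ i i ▸ hne i)
    fun i j hij => (hββ i j).trans (horth hij)]
  ext i j
  rw [Matrix.of_apply, Matrix.of_apply, hββ, hβ, hβ, ← map_mul, ← map_mul, hform _ (hpU i j)]

end QuotientAlgebra

end PolyOpt

end

theorem proposition5p1_general {n : ℕ} (f : PolyOpt.Poly n) (S : Set (Fin n → ℝ))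
    (G : PolyOpt.Constraints n) (hGS : G.feasible ⊆ S)
    (hVG : PolyOpt.minimizers f S ⊆ G.feasible)
    (hinf : IsGLB ((fun x => MvPolynomial.eval x f) '' S) (PolyOpt.infValue f G.feasible))
    (E : Submodule ℝ (PolyOpt.Poly n)) [FiniteDimensional ℝ E]
    (Λ : Module.Dual ℝ ↥(E * E)) (hΛ : PolyOpt.IsOptimalForm f E G Λ)
    {ι : Type*} [Fintype ι] [DecidableEq ι] (b : ι → PolyOpt.Poly n)
    (hne : ∀ i, PolyOpt.formAt Λ (b i * b i) ≠ 0)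
    (horth : Pairwise fun i j => PolyOpt.formAt Λ (b i * b j) = 0)
    (W : Submodule ℝ (PolyOpt.Poly n)) (hWE : W ≤ E) (hW : PolyOpt.ConnectedToOne W)
    (hBW : PolyOpt.prolong (Submodule.span ℝ (Set.range b)) ≤ W)
    (hflat : PolyOpt.IsFlatExtension ((PolyOpt.le_prolong _).trans hBW)
      (PolyOpt.restrictForm hWE Λ))
    (hfW : f ∈ W * W)
    (hG₀ : ∀ q ∈ G.eqs, ∀ v ∈ Submodule.span ℝ (Set.range b), q * v ∈ W * W)
    (hG₁ : ∀ q ∈ G.nonnegs, ∀ v ∈ Submodule.span ℝ (Set.range b),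
      ∀ w ∈ Submodule.span ℝ (Set.range b), q * (v * w) ∈ W * W) :
    ∃ β : Module.Basis ι ℝ (PolyOpt.MinAlgebra f S),
      (∀ i, β i = Ideal.Quotient.mk (PolyOpt.minIdeal f S) (b i)) ∧
      (∀ k : Fin n, LinearMap.toMatrix β β (PolyOpt.mulOp f S k) =
        Matrix.of fun i j =>
          PolyOpt.formAt Λ (MvPolynomial.X k * b i * b j) / PolyOpt.formAt Λ (b i * b i)) ∧
      ∃ (ξ : ι → Fin n → ℝ) (u : ι → PolyOpt.MinAlgebra f S),
        Function.Injective ξ ∧ Set.range ξ = PolyOpt.minimizers f S ∧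
        LinearIndependent ℝ u ∧ ∀ i k, PolyOpt.mulOp f S k (u i) = ξ i k • u i := by
  have hbW : ∀ i, b i ∈ W := fun i =>
    hBW (PolyOpt.le_prolong _ (Submodule.subset_span (Set.mem_range_self i)))
  have hXbW : ∀ k i, MvPolynomial.X k * b i ∈ W := fun k i =>
    hBW (PolyOpt.X_mul_mem_prolong (Submodule.subset_span (Set.mem_range_self i)) k)
  obtain ⟨ξ, w, hq⟩ := PolyOpt.exists_quadrature_of_isFlatExtension_restrictForm hΛ.1 hWE hW
    hBW hflat hne horth
  have hξ : ∀ i, ξ i ∈ G.feasible := PolyOpt.node_mem_feasible hΛ.1 hq (mul_le_mul' hWE hWE)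
    (((PolyOpt.le_prolong _).trans hBW).trans hWE) hG₀ hG₁
  have hrange : Set.range ξ = PolyOpt.minimizers f S :=
    hΛ.range_eq_minimizers hWE hW.one_mem hfW hBW hq hξ hGS hVG hinf
  have hI : PolyOpt.minIdeal f S = RingHom.ker (PolyOpt.evalAt ξ) := by
    rw [PolyOpt.minIdeal, ← hrange, PolyOpt.vanishingIdeal_range]
  obtain ⟨β, hβ⟩ := PolyOpt.exists_basis_quotient hI hq.exists_interpolant
  obtain ⟨u, hu, hMu⟩ := PolyOpt.exists_linearIndependent_eigenvectors hI hq.surjective_evalAt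
  refine ⟨β, hβ, fun k => ?_, ξ, u, hq.injective, hrange, hu, fun i k => ?_⟩
  · exact hq.toMatrix_mulLeft hI hβ (fun i j => Submodule.mul_mem_mul (hbW i) (hbW j)) hne horth
      fun i j => Submodule.mul_mem_mul (hXbW k i) (hbW j)
  · exact (hMu i (MvPolynomial.X k)).trans (by rw [MvPolynomial.eval_X])

theorem proposition5p1 {n : ℕ}
    -- the minimization problem: minimize `f` on the non-empty set `S = 𝒮(g)`
    (f : PolyOpt.Poly n) (g : PolyOpt.Constraints n)
    (hg₀ : g.eqs.Finite) (hg₁ : g.nonnegs.Finite) (hS : g.feasible.Nonempty)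
    (hbdd : BddBelow ((fun x => MvPolynomial.eval x f) '' g.feasible))
    -- the constraints `G` of the relaxation: `V_min ⊆ 𝒮(G) ⊆ S` and the same infimum
    (G : PolyOpt.Constraints n) (hGS : G.feasible ⊆ g.feasible)
    (hVG : PolyOpt.minimizers f g.feasible ⊆ G.feasible)
    (hinf : PolyOpt.infValue f G.feasible = PolyOpt.infValue f g.feasible)
    -- the linear form `Λ`, optimal for `f`, and the output `b` of a successful decomposition
    (E : Submodule ℝ (PolyOpt.Poly n)) (hEfin : FiniteDimensional ℝ E)
    (hE : PolyOpt.ConnectedToOne E)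
    (Λ : Module.Dual ℝ ↥(E * E)) (hΛ : PolyOpt.IsOptimalForm f E G Λ)
    {r : ℕ} (b : Fin r → PolyOpt.Poly n)
    (hb : PolyOpt.DecompositionSucceeds E Λ (List.ofFn b))
    -- the flat extension property holds on some `W` with `⟨B⟩⁺ ⊆ W ⊆ E` that is large enough
    -- for `f` and the constraints
    (W : Submodule ℝ (PolyOpt.Poly n)) (hWE : W ≤ E) (hW : PolyOpt.ConnectedToOne W)
    (hBW : PolyOpt.prolong (Submodule.span ℝ (Set.range b)) ≤ W)
    (hflat : PolyOpt.IsFlatExtension ((PolyOpt.le_prolong _).trans hBW)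
      (PolyOpt.restrictForm hWE Λ))
    (hfW : f ∈ W * W)
    (hG₀ : ∀ q ∈ G.eqs, ∀ v ∈ Submodule.span ℝ (Set.range b), q * v ∈ W * W)
    (hG₁ : ∀ q ∈ G.nonnegs, ∀ v ∈ Submodule.span ℝ (Set.range b),
      ∀ w ∈ Submodule.span ℝ (Set.range b), q * (v * w) ∈ W * W) :
    (∀ i, PolyOpt.formAt Λ (b i * b i) ≠ 0) ∧
    ∃ β : Module.Basis (Fin r) ℝ (PolyOpt.MinAlgebra f g.feasible),
      (∀ i, β i = Ideal.Quotient.mk (PolyOpt.minIdeal f g.feasible) (b i)) ∧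
      (∀ k : Fin n, LinearMap.toMatrix β β (PolyOpt.mulOp f g.feasible k) =
        Matrix.of fun i j =>
          PolyOpt.formAt Λ (MvPolynomial.X k * b i * b j) / PolyOpt.formAt Λ (b i * b i)) ∧
      ∃ (ξ : Fin r → Fin n → ℝ) (u : Fin r → PolyOpt.MinAlgebra f g.feasible),
        Function.Injective ξ ∧ Set.range ξ = PolyOpt.minimizers f g.feasible ∧
        LinearIndependent ℝ u ∧
        ∀ i k, PolyOpt.mulOp f g.feasible k (u i) = ξ i k • u i := by
  have h1 : PolyOpt.formAt Λ 1 ≠ 0 := hΛ.1.2.symm ▸ one_ne_zero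
  have hne : ∀ i, PolyOpt.formAt Λ (b i * b i) ≠ 0 := fun i =>
    (hb.1.orthogonal h1).1 _ (List.mem_ofFn.mpr ⟨i, rfl⟩)
  exact ⟨hne, proposition5p1_general f g.feasible G hGS hVG
    (hinf ▸ isGLB_csInf (hS.image _) hbdd) E Λ hΛ b hne (hb.1.pairwise_of_ofFn h1) W hWE hW hBW
    hflat hfW hG₀ hG₁⟩
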